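/- For a finite group $G$ let $L(G)$ be its set of subgroups, $C(G)$ its set of cyclic subgroups, and $\operatorname{cdeg}(G)=|C(G)|/|L(G)|$ its cyclicity degree. For $\alpha\ge 0$ put $a_{\alpha,2}=|L(\mathbb{Z}_2^{\alpha})|$, put $a_{-1,2}=0$, and for $n\ge 0$ let $$b_{n,2}=2^{n+2}+1+8\sum_{\alpha=0}^{n-2}\left(2^{n+\alpha}-2^{2\alpha+1}+2^{\alpha}\right)a_{\alpha,2}+2^{n+2}a_{n-1,2}+a_{n,2},$$ where the sum is $0$ for $n\le 1$. Let $n\ge 0$, let $A$ be a finite abelian group of odd order, and let $H$ be a (hamiltonian) group isomorphic to $Q_8\times\mathbb{Z}_2^n\times A$, where $Q_8$ is the quaternion group of order $8$. Then $$|L(Q_8\times\mathbb{Z}_2^n)|=b_{n,2},\qquad |C(Q_8\times\mathbb{Z}_2^n)|=5\cdot 2^n,\qquad \operatorname{cdeg}(H)=\frac{5\cdot 2^n}{b_{n,2}}\,\operatorname{cdeg}(A).$$ -/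

import Mathlib

/-- `|L(G)|`, the number of subgroups of `G`. -/
noncomputable def numSubgroups (G : Type*) [Group G] : ℕ :=
  Nat.card (Subgroup G)

/-- `|C(G)|`, the number of cyclic subgroups of `G`. -/
noncomputable def numCyclicSubgroups (G : Type*) [Group G] : ℕ :=
  Nat.card {K : Subgroup G // IsCyclic K}

/-- The cyclicity degree `|C(G)| / |L(G)|` of a (finite) group `G`. -/
noncomputable def cdeg (G : Type*) [Group G] : ℚ :=
  (numCyclicSubgroups G : ℚ) / (numSubgroups G : ℚ)

/-- The elementary abelian `2`-group `ℤ₂ⁿ`, written multiplicatively. -/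
abbrev ElemTwo (n : ℕ) : Type := Fin n → Multiplicative (ZMod 2)

/-- `a_{α,2} = |L(ℤ₂^α)|`. -/
noncomputable def aTwo (α : ℕ) : ℕ := numSubgroups (ElemTwo α)

/-- The explicit number
`b_{n,2} = 2^(n+2) + 1 + 8 ∑_{α=0}^{n-2} (2^(n+α) - 2^(2α+1) + 2^α) a_{α,2}
  + 2^(n+2) a_{n-1,2} + a_{n,2}`.
The sum is empty for `n ≤ 1`, and `a_{-1,2} = 0`, so the term with `a_{n-1,2}` is absent for
`n = 0`. -/
noncomputable def bTwo (n : ℕ) : ℤ :=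
  2 ^ (n + 2) + 1
    + 8 * ∑ α ∈ Finset.range (n - 1),
        ((2 : ℤ) ^ (n + α) - 2 ^ (2 * α + 1) + 2 ^ α) * (aTwo α : ℤ)
    + (if n = 0 then 0 else 2 ^ (n + 2) * (aTwo (n - 1) : ℤ))
    + (aTwo n : ℤ)

/-! Write `a m` for `aTwo m`, and let `z` be the involution of `Q₈ × ℤ₂ⁿ` that is a square.
Subgroups containing `z` are those of the quotient by `⟨z⟩`, which is `ℤ₂ⁿ⁺²`. A subgroup omitting
`z` has no element of order four, so it lies in the socle `ℤ₂ⁿ⁺¹`; there `a (n+1) - a n` subgroups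
omit `z`. Hence `|L| = a (n+2) + a (n+1) - a n`, and the Galois recursion `aTwo_add_two` collapses
the sum in `bTwo` to the same value (`bTwo_eq`).

Cyclic subgroups are counted by generators up to inversion, and the odd factor splits off because
`cdeg` is multiplicative over coprime orders. -/

/-! ### Counting subgroups through a central involution -/

theorem numSubgroups_congr {G H : Type*} [Group G] [Group H] (e : G ≃* H) :
    numSubgroups G = numSubgroups H :=
  Nat.card_congr e.mapSubgroup.toEquiv

theorem numCyclicSubgroups_congr {G H : Type*} [Group G] [Group H] (e : G ≃* H) :
    numCyclicSubgroups G = numCyclicSubgroups H :=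
  Nat.card_congr <| e.mapSubgroup.toEquiv.subtypeEquiv fun K =>
    (e.subgroupMap K).isCyclic

/-- A commutative group of exponent dividing two and order `2 ^ m` is `ℤ₂ᵐ`. -/
theorem CommGroup.nonempty_mulEquiv_elemTwo {G : Type*} [CommGroup G] {m : ℕ}
    (hsq : ∀ g : G, g * g = 1) (hcard : Nat.card G = 2 ^ m) : Nonempty (G ≃* ElemTwo m) := by
  have hfin : Finite G := Nat.finite_of_card_ne_zero (by simp [hcard])
  let : Module (ZMod 2) (Additive G) := AddCommGroup.zmodModule fun x => by
    rw [two_nsmul]; exact hsq x.toMul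
  have : Fintype (Additive G) := Fintype.ofFinite _
  have hrank : Module.finrank (ZMod 2) (Additive G) = m := by
    have h := Module.card_eq_pow_finrank (K := ZMod 2) (V := Additive G)
    rw [ZMod.card, ← Nat.card_eq_fintype_card] at h
    exact Nat.pow_right_injective le_rfl (h.symm.trans hcard)
  let e : Additive G ≃ₗ[ZMod 2] (Fin m → ZMod 2) :=
    LinearEquiv.ofFinrankEq _ _ (by rw [hrank, Module.finrank_fin_fun])
  exact ⟨{ toFun := fun g i => Multiplicative.ofAdd (e (Additive.ofMul g) i)
           invFun := fun v => (e.symm fun i => (v i).toAdd).toMul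
           left_inv := fun g => by simp
           right_inv := fun v => by simp
           map_mul' := fun g h => by ext i; simp }⟩

theorem numSubgroups_eq_aTwo {G : Type*} [Group G] {m : ℕ}
    (hsq : ∀ g : G, g * g = 1) (hcard : Nat.card G = 2 ^ m) : numSubgroups G = aTwo m := by
  let : CommGroup G :=
    { ‹Group G› with
      mul_comm := fun a b => by
        have h := hsq (a * b)
        rw [← inv_eq_iff_mul_eq_one, mul_inv_rev, inv_eq_of_mul_eq_one_left (hsq a),
          inv_eq_of_mul_eq_one_left (hsq b)] at h
        exact h.symm }
  obtain ⟨e⟩ := CommGroup.nonempty_mulEquiv_elemTwo hsq hcard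
  exact numSubgroups_congr e

theorem card_subgroups_ge_normal {G : Type*} [Group G] (N : Subgroup G) [N.Normal] :
    Nat.card {K : Subgroup G // N ≤ K} = numSubgroups (G ⧸ N) :=
  Nat.card_congr (QuotientGroup.comapMk'OrderIso N).symm.toEquiv

/-- If `z` is a central involution such that `G / ⟨z⟩` has exponent dividing two, the subgroups
containing `z` are counted by `aTwo`. -/
theorem card_subgroups_mem_eq_aTwo {G : Type*} [Group G] {m : ℕ} {z : G}
    (hz : z ∈ Subgroup.center G) (hz1 : z ≠ 1) (hz2 : z * z = 1)
    (hsq : ∀ g : G, g * g ∈ Subgroup.zpowers z) (hcard : Nat.card G = 2 ^ (m + 1)) :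
    Nat.card {K : Subgroup G // z ∈ K} = aTwo m := by
  have hN : (Subgroup.zpowers z).Normal :=
    ⟨fun g hg x => by
      have hc : Subgroup.zpowers z ≤ Subgroup.center G := by simpa [Subgroup.zpowers_le] using hz
      rwa [Subgroup.mem_center_iff.mp (hc hg) x, mul_inv_cancel_right]⟩
  have hord : Nat.card (Subgroup.zpowers z) = 2 := by
    rw [Nat.card_zpowers]; exact orderOf_eq_prime (by rw [pow_two, hz2]) hz1
  rw [← numSubgroups_eq_aTwo (G := G ⧸ Subgroup.zpowers z), ← card_subgroups_ge_normal]
  · simp only [Subgroup.zpowers_le]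
  · intro g
    induction g using QuotientGroup.induction_on with
    | H g => rw [← QuotientGroup.mk_mul, QuotientGroup.eq_one_iff]; exact hsq g
  · have h := Subgroup.card_eq_card_quotient_mul_card_subgroup (Subgroup.zpowers z)
    rw [hcard, hord, pow_succ] at h
    omega

theorem card_subgroups_mem_add_not_mem {G : Type*} [Group G] [Finite G] (z : G) :
    Nat.card {K : Subgroup G // z ∈ K} + Nat.card {K : Subgroup G // z ∉ K} = numSubgroups G := by
  classical
  rw [numSubgroups, ← Nat.card_sum]
  exact Nat.card_congr (Equiv.sumCompl _)

theorem card_elemTwo (n : ℕ) : Nat.card (ElemTwo n) = 2 ^ n := by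
  simp [ElemTwo]

theorem elemTwo_mul_self {n : ℕ} (v : ElemTwo n) : v * v = 1 := by
  ext i
  exact CharTwo.add_self_eq_zero (v i).toAdd

/-- The subgroups of an elementary abelian two-group of order `2 ^ (m + 1)` not containing a given
nontrivial element. -/
theorem card_subgroups_not_mem {G : Type*} [Group G] {m : ℕ} (hsq : ∀ g : G, g * g = 1)
    (hcard : Nat.card G = 2 ^ (m + 1)) {z : G} (hz : z ∈ Subgroup.center G) (hz1 : z ≠ 1) :
    aTwo m + Nat.card {K : Subgroup G // z ∉ K} = aTwo (m + 1) := by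
  have : Finite G := Nat.finite_of_card_ne_zero (by simp [hcard])
  rw [← card_subgroups_mem_eq_aTwo hz hz1 (hsq z) (fun g => by simp [hsq g]) hcard,
    card_subgroups_mem_add_not_mem, numSubgroups_eq_aTwo hsq hcard]

/-! ### The Galois recursion over `𝔽₂` -/

/-- Linear partial maps are the submodules of a product meeting the second factor trivially. -/
noncomputable def LinearPMap.equivGraph (R E F : Type*) [Ring R] [AddCommGroup E] [AddCommGroup F]
    [Module R E] [Module R F] :
    (E →ₗ.[R] F) ≃ {g : Submodule R (E × F) // ∀ x ∈ g, x.1 = 0 → x.2 = 0} where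
  toFun f := ⟨f.graph, fun _ hx h => f.graph_fst_eq_zero_snd hx h⟩
  invFun g := g.1.toLinearPMap
  left_inv f := LinearPMap.eq_of_eq_graph
    (Submodule.toLinearPMap_graph_eq _ fun _ hx h => f.graph_fst_eq_zero_snd hx h)
  right_inv g := Subtype.ext (Submodule.toLinearPMap_graph_eq _ g.2)

def LinearPMap.equivSigma (R E F : Type*) [Ring R] [AddCommGroup E] [AddCommGroup F]
    [Module R E] [Module R F] :
    (E →ₗ.[R] F) ≃ Σ C : Submodule R E, C →ₗ[R] F where
  toFun f := ⟨f.domain, f.toFun⟩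
  invFun s := ⟨s.1, s.2⟩

theorem Module.card_dual_zmod_two (C : Type*) [AddCommGroup C] [Module (ZMod 2) C] [Finite C] :
    Nat.card (C →ₗ[ZMod 2] ZMod 2) = Nat.card C := by
  rw [Module.natCard_eq_pow_finrank (K := ZMod 2) (V := C),
    Module.natCard_eq_pow_finrank (K := ZMod 2) (V := C →ₗ[ZMod 2] ZMod 2)]
  congr 1
  exact Subspace.dual_finrank_eq

/-- Subgroups of `Multiplicative M`, for `M` a vector space over `𝔽₂`, are its subspaces. -/
def subgroupMultiplicativeEquivSubmodule (M : Type*) [AddCommGroup M] [Module (ZMod 2) M] :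
    Subgroup (Multiplicative M) ≃ Submodule (ZMod 2) M :=
  (AddSubgroup.toSubgroup (A := M)).symm.toEquiv.trans (AddSubgroup.toZModSubmodule 2).toEquiv

theorem ofAdd_mul_self_zmod_two {M : Type*} [AddCommGroup M] [Module (ZMod 2) M]
    (x : Multiplicative M) : x * x = 1 :=
  ZModModule.add_self (x.toAdd)

/-- A subspace of `E × 𝔽₂` omitting `(0, 1)` is the graph of a functional on a subspace `C` of `E`,
and `C` has as many functionals as elements. -/
theorem aTwo_add_sum_card (n : ℕ) :
    aTwo n + Nat.card (Σ C : Submodule (ZMod 2) (Fin n → ZMod 2), C) = aTwo (n + 1) := by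
  classical
  let E := Fin n → ZMod 2
  have hz : (Multiplicative.ofAdd ((0, 1) : E × ZMod 2)) ≠ 1 := by
    intro h
    exact one_ne_zero (congrArg Prod.snd (Multiplicative.ofAdd.injective h))
  rw [← card_subgroups_not_mem (G := Multiplicative (E × ZMod 2)) ofAdd_mul_self_zmod_two
    (by simp [E, pow_succ]) (z := Multiplicative.ofAdd (0, 1))
    (by rw [CommGroup.center_eq_top]; trivial) hz]
  congr 1
  have h₁ : Nat.card {K : Subgroup (Multiplicative (E × ZMod 2)) //
      Multiplicative.ofAdd ((0, 1) : E × ZMod 2) ∉ K} = Nat.card (E →ₗ.[ZMod 2] ZMod 2) := by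
    refine Nat.card_congr (Equiv.trans ?_ (LinearPMap.equivGraph _ _ _).symm)
    refine (subgroupMultiplicativeEquivSubmodule _).subtypeEquiv fun K => ?_
    -- Since `1` is the only nonzero scalar, omitting `(0, 1)` means meeting the second factor
    -- trivially.
    constructor
    · rintro h ⟨x, y⟩ hxy (rfl : x = 0)
      fin_cases y
      · rfl
      · exact absurd hxy h
    · intro h hmem
      exact one_ne_zero (h (0, 1) hmem rfl)
  have hfin (C : Submodule (ZMod 2) E) : Finite (C →ₗ[ZMod 2] ZMod 2) := DFunLike.finite _
  rw [h₁, Nat.card_congr (LinearPMap.equivSigma _ _ _), Nat.card_sigma, Nat.card_sigma]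
  simp only [Module.card_dual_zmod_two]
  rfl

/-- Double counting by the vector: zero lies in every subspace, and the subspaces through a nonzero
vector are those of the quotient by its line. -/
theorem card_sigma_submodule (n : ℕ) :
    Nat.card (Σ C : Submodule (ZMod 2) (Fin (n + 1) → ZMod 2), C) =
      aTwo (n + 1) + (2 ^ (n + 1) - 1) * aTwo n := by
  classical
  let E := Fin (n + 1) → ZMod 2
  have hcard : Nat.card (Multiplicative E) = 2 ^ (n + 1) := by simp [E]
  let e : (Σ C : Submodule (ZMod 2) E, C) ≃
      Σ v : Multiplicative E, {K : Subgroup (Multiplicative E) // v ∈ K} :=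
    { toFun := fun s => ⟨Multiplicative.ofAdd s.2.1,
        (subgroupMultiplicativeEquivSubmodule E).symm s.1, s.2.2⟩
      invFun := fun s => ⟨subgroupMultiplicativeEquivSubmodule E s.2.1, s.1.toAdd, s.2.2⟩ }
  rw [Nat.card_congr e, Nat.card_sigma, ← Finset.add_sum_erase _ _ (Finset.mem_univ 1)]
  congr 1
  · simp only [one_mem]
    rw [← numSubgroups_eq_aTwo (G := Multiplicative E) ofAdd_mul_self_zmod_two hcard, numSubgroups]
    exact Nat.card_congr (Equiv.subtypeUnivEquiv fun _ => trivial)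
  · rw [Finset.sum_congr rfl (g := fun _ => aTwo n), Finset.sum_const,
      Finset.card_erase_of_mem (Finset.mem_univ _), Finset.card_univ, ← Nat.card_eq_fintype_card,
      hcard, smul_eq_mul]
    intro v hv
    exact card_subgroups_mem_eq_aTwo (by rw [CommGroup.center_eq_top]; trivial)
      (Finset.ne_of_mem_erase hv) (ofAdd_mul_self_zmod_two v)
      (fun g => by rw [ofAdd_mul_self_zmod_two g]; exact one_mem _) hcard

/-- The recursion of the Galois numbers over `𝔽₂`. -/
theorem aTwo_add_two (n : ℕ) :
    (aTwo (n + 2) : ℤ) = 2 * aTwo (n + 1) + (2 ^ (n + 1) - 1) * aTwo n := by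
  rw [← aTwo_add_sum_card, card_sigma_submodule]
  push_cast [Nat.one_le_two_pow]
  ring

theorem aTwo_zero : aTwo 0 = 1 := by
  simp [aTwo, numSubgroups]

theorem aTwo_one : aTwo 1 = 2 := by
  rw [← aTwo_add_sum_card, aTwo_zero, Nat.card_sigma]
  simp

/-! ### Closed form of `bTwo` -/

theorem two_mul_sum_two_pow_mul_aTwo (n : ℕ) :
    2 * ∑ α ∈ Finset.range n, (2 : ℤ) ^ α * aTwo α = aTwo (n + 1) - aTwo n - 1 := by
  induction n with
  | zero => simp [aTwo_zero, aTwo_one]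
  | succ n ih => rw [Finset.sum_range_succ, mul_add, ih, aTwo_add_two]; ring

theorem eight_mul_sum_mul_aTwo (n : ℕ) :
    8 * ∑ α ∈ Finset.range n, ((2 : ℤ) ^ α - 2 ^ (2 * α + 1)) * aTwo α =
      (3 - 2 ^ (n + 2)) * aTwo (n + 1) + (3 * 2 ^ (n + 1) - 3) * aTwo n - 1 := by
  induction n with
  | zero => simp [aTwo_zero, aTwo_one]
  | succ n ih => rw [Finset.sum_range_succ, mul_add, ih, aTwo_add_two]; ring

theorem bTwo_eq (n : ℕ) : bTwo n = aTwo (n + 2) + aTwo (n + 1) - aTwo n := by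
  rcases n with _ | n
  · simp [bTwo, aTwo_add_two, aTwo_zero, aTwo_one]
  · have hsum : ∑ α ∈ Finset.range n,
        ((2 : ℤ) ^ (n + 1 + α) - 2 ^ (2 * α + 1) + 2 ^ α) * (aTwo α : ℤ) =
        2 ^ (n + 1) * ∑ α ∈ Finset.range n, (2 : ℤ) ^ α * aTwo α +
          ∑ α ∈ Finset.range n, ((2 : ℤ) ^ α - 2 ^ (2 * α + 1)) * aTwo α := by
      rw [Finset.mul_sum, ← Finset.sum_add_distrib]
      exact Finset.sum_congr rfl fun α _ => by ring
    have h₁ := two_mul_sum_two_pow_mul_aTwo n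
    have h₂ := eight_mul_sum_mul_aTwo n
    rw [bTwo, Nat.add_sub_cancel, hsum, if_neg n.succ_ne_zero, mul_add, h₂, aTwo_add_two (n + 1),
      aTwo_add_two n]
    -- The outer factor `8 * 2 ^ (n + 1)` is `4 * 2 ^ (n + 1)` times the `2` in `h₁`.
    linear_combination 4 * 2 ^ (n + 1) * h₁

/-! ### Subgroups of `Q₈ × ℤ₂ⁿ` -/

theorem QuaternionGroup.mul_self_eq (q : QuaternionGroup 2) :
    q * q = 1 ∨ q * q = QuaternionGroup.a 2 := by
  revert q; decide

theorem QuaternionGroup.eq_of_mul_self_eq_one (q : QuaternionGroup 2) (h : q * q = 1) :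
    q = 1 ∨ q = QuaternionGroup.a 2 := by
  revert q; decide

theorem QuaternionGroup.a_two_mul_comm (q : QuaternionGroup 2) :
    q * QuaternionGroup.a 2 = QuaternionGroup.a 2 * q := by
  revert q; decide

section QuaternionTimesElementary

variable (n : ℕ)

/-- The central involution of `Q₈ × ℤ₂ⁿ` that is a square. -/
def quaternionElemTwoInvolution : QuaternionGroup 2 × ElemTwo n := (QuaternionGroup.a 2, 1)

theorem quaternionElemTwoInvolution_mul_self :
    quaternionElemTwoInvolution n * quaternionElemTwoInvolution n = 1 :=
  Prod.ext (by decide : (QuaternionGroup.a 2 : QuaternionGroup 2) * QuaternionGroup.a 2 = 1)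
    (mul_one 1)

theorem quaternionElemTwoInvolution_ne_one : quaternionElemTwoInvolution n ≠ 1 := fun h =>
  (by decide : (QuaternionGroup.a 2 : QuaternionGroup 2) ≠ 1) (congrArg Prod.fst h)

theorem quaternionElemTwoInvolution_mem_center :
    quaternionElemTwoInvolution n ∈ Subgroup.center (QuaternionGroup 2 × ElemTwo n) :=
  Subgroup.mem_center_iff.mpr fun g =>
    Prod.ext (QuaternionGroup.a_two_mul_comm g.1) (mul_comm g.2 1)

variable {n} in
theorem quaternionElemTwo_mul_self (g : QuaternionGroup 2 × ElemTwo n) :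
    g * g = 1 ∨ g * g = quaternionElemTwoInvolution n :=
  (QuaternionGroup.mul_self_eq g.1).imp (fun h => Prod.ext h (elemTwo_mul_self g.2))
    (fun h => Prod.ext h (elemTwo_mul_self g.2))

theorem card_quaternionElemTwo : Nat.card (QuaternionGroup 2 × ElemTwo n) = 2 ^ (n + 3) := by
  rw [Nat.card_prod, card_elemTwo, Nat.card_eq_fintype_card, QuaternionGroup.card]
  ring

/-- The elements of `Q₈ × ℤ₂ⁿ` with trivial square. -/
def quaternionElemTwoSocle : Subgroup (QuaternionGroup 2 × ElemTwo n) :=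
  (Subgroup.zpowers (QuaternionGroup.a 2)).prod ⊤

variable {n} in
theorem mem_quaternionElemTwoSocle (g : QuaternionGroup 2 × ElemTwo n) :
    g ∈ quaternionElemTwoSocle n ↔ g * g = 1 := by
  have hsq : (QuaternionGroup.a 2 : QuaternionGroup 2) * QuaternionGroup.a 2 = 1 := by decide
  rw [quaternionElemTwoSocle, Subgroup.mem_prod]
  constructor
  · rintro ⟨⟨k, hk⟩, -⟩
    refine Prod.ext ?_ (elemTwo_mul_self g.2)
    change g.1 * g.1 = 1
    rw [← hk]
    change (QuaternionGroup.a 2 : QuaternionGroup 2) ^ k * QuaternionGroup.a 2 ^ k = 1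
    rw [← (Commute.refl (QuaternionGroup.a 2)).mul_zpow, hsq, one_zpow]
  · intro h
    refine ⟨?_, trivial⟩
    rcases QuaternionGroup.eq_of_mul_self_eq_one g.1 (congrArg Prod.fst h) with h | h
    · rw [h]; exact one_mem _
    · rw [h]; exact Subgroup.mem_zpowers _

theorem card_quaternionElemTwoSocle : Nat.card (quaternionElemTwoSocle n) = 2 ^ (n + 1) := by
  rw [quaternionElemTwoSocle, Nat.card_congr (Subgroup.prodEquiv _ _).toEquiv, Nat.card_prod,
    Nat.card_zpowers, Subgroup.card_top, card_elemTwo,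
    orderOf_eq_prime (p := 2) (by decide) (by decide)]
  ring

/-- Subgroups avoiding the involution lie in the socle, since they contain no element of
order four. -/
theorem aTwo_add_card_involution_not_mem :
    aTwo n + Nat.card {K : Subgroup (QuaternionGroup 2 × ElemTwo n) //
      quaternionElemTwoInvolution n ∉ K} = aTwo (n + 1) := by
  let W := quaternionElemTwoSocle n
  let z : W := ⟨quaternionElemTwoInvolution n,
    (mem_quaternionElemTwoSocle _).mpr (quaternionElemTwoInvolution_mul_self n)⟩
  rw [← card_subgroups_not_mem (G := W) (z := z)
    (fun g => Subtype.ext ((mem_quaternionElemTwoSocle g.1).mp g.2))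
    (card_quaternionElemTwoSocle n)
    (Subgroup.mem_center_iff.mpr fun g => Subtype.ext
      (Subgroup.mem_center_iff.mp (quaternionElemTwoInvolution_mem_center n) g.1))
    (fun h => quaternionElemTwoInvolution_ne_one n (congrArg Subtype.val h))]
  congr 1
  refine Nat.card_congr
    { toFun := fun K => ⟨K.1.subgroupOf W, fun h => K.2 h⟩
      invFun := fun L => ⟨L.1.map W.subtype, ?_⟩
      left_inv := fun K => Subtype.ext ?_
      right_inv := fun L => Subtype.ext ?_ }
  · rintro ⟨x, hx, hxz⟩
    have hxz : x = z := Subtype.ext hxz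
    rw [hxz] at hx
    exact L.2 hx
  · refine Subgroup.map_subgroupOf_eq_of_le fun g hg => ?_
    refine (mem_quaternionElemTwoSocle g).mpr ((quaternionElemTwo_mul_self g).resolve_right ?_)
    intro h
    have hmem := mul_mem hg hg
    rw [h] at hmem
    exact K.2 hmem
  · exact Subgroup.comap_map_eq_self_of_injective W.subtype_injective L.1

theorem numSubgroups_quaternionElemTwo_add :
    numSubgroups (QuaternionGroup 2 × ElemTwo n) + aTwo n = aTwo (n + 2) + aTwo (n + 1) := by
  rw [← card_subgroups_mem_add_not_mem (quaternionElemTwoInvolution n),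
    card_subgroups_mem_eq_aTwo (m := n + 2) (quaternionElemTwoInvolution_mem_center n)
      (quaternionElemTwoInvolution_ne_one n) (quaternionElemTwoInvolution_mul_self n)
      (fun g => ?_) (card_quaternionElemTwo n), ← aTwo_add_card_involution_not_mem n]
  · ring
  · rcases quaternionElemTwo_mul_self g with h | h <;> rw [h]
    · exact one_mem _
    · exact Subgroup.mem_zpowers _

theorem numSubgroups_quaternionElemTwo :
    (numSubgroups (QuaternionGroup 2 × ElemTwo n) : ℤ) = bTwo n := by
  have h := numSubgroups_quaternionElemTwo_add n
  rw [bTwo_eq]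
  lia

end QuaternionTimesElementary

/-! ### Cyclic subgroups of `Q₈ × ℤ₂ⁿ` -/

/-- In a group of exponent dividing four a cyclic subgroup has, up to inversion, one generator. -/
theorem eq_or_eq_inv_of_zpowers_eq {G : Type*} [Group G] {g h : G} (hg : g ^ 4 = 1)
    (hgh : Subgroup.zpowers g = Subgroup.zpowers h) : h = g ∨ h = g⁻¹ := by
  obtain ⟨k, rfl⟩ := Subgroup.mem_zpowers_iff.mp (hgh ▸ Subgroup.mem_zpowers h)
  obtain ⟨l, hl⟩ := Subgroup.mem_zpowers_iff.mp (hgh ▸ Subgroup.mem_zpowers g)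
  have hg' : g ^ (4 : ℤ) = 1 := by exact_mod_cast hg
  rw [← zpow_mul] at hl
  have key (m : ℤ) : g ^ (4 * m) = 1 := by rw [zpow_mul, hg', one_zpow]
  -- If `k` is even, `g` is a power of `g ^ 2`, which forces `g = 1`; if `k` is odd, it is `±1`
  -- modulo `4`.
  rcases Int.emod_two_eq_zero_or_one k with hk | hk
  · obtain ⟨j, rfl⟩ : ∃ j, k = 2 * j := ⟨k / 2, by lia⟩
    have hsq : g ^ (2 : ℤ) = 1 := by
      rw [← hl, ← zpow_mul, ← key (j * l)]
      congr 1; ring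
    have hg1 : g = 1 := by rw [← hl, mul_assoc, zpow_mul, hsq, one_zpow]
    simp [hg1]
  · rcases (by lia : k % 4 = 1 ∨ k % 4 = 3) with hk | hk
    · left
      rw [← Int.emod_add_mul_ediv k 4, hk, zpow_add, key, zpow_one, mul_one]
    · right
      rw [(by lia : k = -1 + 4 * (k / 4 + 1)), zpow_add, key, zpow_neg_one, mul_one]

/-- One generator for each cyclic subgroup of `Q₈`. -/
def quaternionCyclicGenerator : Fin 5 → QuaternionGroup 2 :=
  ![.a 0, .a 1, .a 2, .xa 0, .xa 1]

theorem numCyclicSubgroups_quaternionElemTwo (n : ℕ) :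
    numCyclicSubgroups (QuaternionGroup 2 × ElemTwo n) = 5 * 2 ^ n := by
  have hcard : Nat.card (Fin 5 × ElemTwo n) = 5 * 2 ^ n := by
    rw [Nat.card_prod, card_elemTwo, Nat.card_fin]
  rw [← hcard]
  let f : Fin 5 × ElemTwo n → {K : Subgroup (QuaternionGroup 2 × ElemTwo n) // IsCyclic K} :=
    fun x => ⟨Subgroup.zpowers (quaternionCyclicGenerator x.1, x.2), inferInstance⟩
  refine (Nat.card_congr (Equiv.ofBijective f ⟨?_, ?_⟩)).symm
  · rintro ⟨i, v⟩ ⟨j, w⟩ h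
    have hinv (u : ElemTwo n) : u⁻¹ = u := inv_eq_of_mul_eq_one_left (elemTwo_mul_self u)
    have h4 : ∀ i, quaternionCyclicGenerator i ^ 4 = 1 := by decide
    have hpow : (quaternionCyclicGenerator i, v) ^ 4 = 1 :=
      Prod.ext (h4 i) (by
        change v ^ 4 = 1
        rw [pow_mul v 2 2, pow_two v, elemTwo_mul_self, one_pow])
    have hinj : ∀ i j, (quaternionCyclicGenerator j = quaternionCyclicGenerator i ∨
        quaternionCyclicGenerator j = (quaternionCyclicGenerator i)⁻¹) → i = j := by decide
    rcases eq_or_eq_inv_of_zpowers_eq hpow (congrArg Subtype.val h) with h | h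
    · exact Prod.ext (hinj i j (.inl (congrArg Prod.fst h))) (congrArg Prod.snd h).symm
    · exact Prod.ext (hinj i j (.inr (congrArg Prod.fst h)))
        ((congrArg Prod.snd h).trans (hinv v)).symm
  · rintro ⟨K, hK⟩
    obtain ⟨⟨q, v⟩, rfl⟩ := (Subgroup.isCyclic_iff_exists_zpowers_eq_top K).mp hK
    have hsurj : ∀ q, ∃ i, quaternionCyclicGenerator i = q ∨ quaternionCyclicGenerator i = q⁻¹ := by
      decide
    obtain ⟨i, rfl | hi⟩ := hsurj q
    · exact ⟨(i, v), rfl⟩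
    -- Inverting both coordinates keeps the cyclic subgroup.
    · refine ⟨(i, v⁻¹), Subtype.ext ?_⟩
      change Subgroup.zpowers (quaternionCyclicGenerator i, v⁻¹) = Subgroup.zpowers (q, v)
      rw [hi, ← Prod.inv_mk, Subgroup.zpowers_inv]

/-! ### Products of coprime order -/

section CoprimeProduct

variable {G A : Type*} [Group G] [Group A]

/-- An exponent that is `1` modulo one order and `0` modulo the other makes each coordinate
projection a power map, which preserves `K`. -/
theorem Subgroup.mk_one_mem_of_coprime (h : (Nat.card G).Coprime (Nat.card A))
    {K : Subgroup (G × A)} {x : G × A} (hx : x ∈ K) : (x.1, 1) ∈ K ∧ (1, x.2) ∈ K := by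
  obtain ⟨m, hmG, hmA⟩ := Nat.chineseRemainder h 1 0
  obtain ⟨l, hlG, hlA⟩ := Nat.chineseRemainder h 0 1
  have h₁ : x ^ m = (x.1, 1) := Prod.ext
    ((pow_eq_pow_iff_modEq.mpr (hmG.of_dvd (_root_.orderOf_dvd_natCard x.1))).trans (pow_one _))
    ((pow_eq_pow_iff_modEq.mpr (hmA.of_dvd (_root_.orderOf_dvd_natCard x.2))).trans (pow_zero _))
  have h₂ : x ^ l = (1, x.2) := Prod.ext
    ((pow_eq_pow_iff_modEq.mpr (hlG.of_dvd (_root_.orderOf_dvd_natCard x.1))).trans (pow_zero _))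
    ((pow_eq_pow_iff_modEq.mpr (hlA.of_dvd (_root_.orderOf_dvd_natCard x.2))).trans (pow_one _))
  exact ⟨h₁ ▸ pow_mem hx m, h₂ ▸ pow_mem hx l⟩

/-- Subgroups of a product of groups of coprime orders are products of subgroups. -/
def Subgroup.prodEquivOfCoprime (h : (Nat.card G).Coprime (Nat.card A)) :
    Subgroup G × Subgroup A ≃ Subgroup (G × A) where
  toFun P := P.1.prod P.2
  invFun K := (K.comap (MonoidHom.inl G A), K.comap (MonoidHom.inr G A))
  left_inv P := by
    ext x <;> simp [Subgroup.mem_prod]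
  right_inv K := by
    ext x
    constructor
    · rintro ⟨h₁, h₂⟩
      simpa using mul_mem (show (x.1, (1 : A)) ∈ K from h₁) (show ((1 : G), x.2) ∈ K from h₂)
    · exact fun hx => Subgroup.mk_one_mem_of_coprime h hx

theorem numSubgroups_prod_of_coprime (h : (Nat.card G).Coprime (Nat.card A)) :
    numSubgroups (G × A) = numSubgroups G * numSubgroups A := by
  rw [numSubgroups, ← Nat.card_congr (Subgroup.prodEquivOfCoprime h), Nat.card_prod]
  rfl

theorem Subgroup.isCyclic_prod_iff_of_coprime (h : (Nat.card G).Coprime (Nat.card A))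
    (K : Subgroup G) (L : Subgroup A) : IsCyclic (K.prod L) ↔ IsCyclic K ∧ IsCyclic L := by
  rw [(Subgroup.prodEquiv K L).isCyclic, Group.isCyclic_prod_iff]
  exact ⟨fun h => ⟨h.1, h.2.1⟩, fun hKL => ⟨hKL.1, hKL.2,
    (h.coprime_dvd_left K.card_subgroup_dvd_card).coprime_dvd_right L.card_subgroup_dvd_card⟩⟩

theorem numCyclicSubgroups_prod_of_coprime (h : (Nat.card G).Coprime (Nat.card A)) :
    numCyclicSubgroups (G × A) = numCyclicSubgroups G * numCyclicSubgroups A := by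
  rw [numCyclicSubgroups, numCyclicSubgroups, numCyclicSubgroups, ← Nat.card_prod]
  refine Nat.card_congr (Equiv.trans (Equiv.symm ?_) Equiv.subtypeProdEquivProd)
  exact (Subgroup.prodEquivOfCoprime h).subtypeEquiv fun P =>
    (Subgroup.isCyclic_prod_iff_of_coprime h P.1 P.2).symm

theorem cdeg_prod_of_coprime (h : (Nat.card G).Coprime (Nat.card A)) :
    cdeg (G × A) = cdeg G * cdeg A := by
  rw [cdeg, numCyclicSubgroups_prod_of_coprime h, numSubgroups_prod_of_coprime h, cdeg, cdeg,
    Nat.cast_mul, Nat.cast_mul, mul_div_mul_comm]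

end CoprimeProduct

theorem cdeg_congr {G H : Type*} [Group G] [Group H] (e : G ≃* H) : cdeg G = cdeg H := by
  rw [cdeg, cdeg, numSubgroups_congr e, numCyclicSubgroups_congr e]

theorem theorem3p2p1 (n : ℕ) {A : Type*} [CommGroup A] (hA : Odd (Nat.card A))
    {H : Type*} [Group H] (hH : Nonempty (H ≃* QuaternionGroup 2 × ElemTwo n × A)) :
    (numSubgroups (QuaternionGroup 2 × ElemTwo n) : ℤ) = bTwo n ∧
    numCyclicSubgroups (QuaternionGroup 2 × ElemTwo n) = 5 * 2 ^ n ∧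
    cdeg H = (5 * 2 ^ n : ℚ) / (bTwo n : ℚ) * cdeg A := by
  refine ⟨numSubgroups_quaternionElemTwo n, numCyclicSubgroups_quaternionElemTwo n, ?_⟩
  obtain ⟨e⟩ := hH
  have hcop : (Nat.card (QuaternionGroup 2 × ElemTwo n)).Coprime (Nat.card A) := by
    rw [card_quaternionElemTwo]
    exact (Nat.coprime_two_left.mpr hA).pow_left _
  rw [cdeg_congr (e.trans MulEquiv.prodAssoc.symm), cdeg_prod_of_coprime hcop,
    cdeg, numCyclicSubgroups_quaternionElemTwo,
    ← numSubgroups_quaternionElemTwo]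
  push_cast
  rfl
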